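/- **Theorem 5.2.** Let $M$ be a (possibly infinite) matroid with ground set $E$, and suppose that $M$ is tame, i.e. $o\cap b$ is finite for every circuit $o$ and every cocircuit $b$ of $M$. Then the following are equivalent. 1. $M$ is a thin sums matroid over every field $k$. That is, for every field $k$ there are a set $A$ and a family $(f_e)_{e\in E}$ of functions $f_e\colon A\to k$ such that a set $I\subseteq E$ is independent in $M$ if and only if the only thin dependence $(\lambda_e)_{e\in E}$ of $(f_e)_{e\in E}$ with $\lambda_e=0$ for all $e\in E\setminus I$ is the zero family. Here a family $(\lambda_e)_{e\in E}$ of elements of $k$ is a thin dependence of $(f_e)_{e\in E}$ if for every $a\in A$ only finitely many of the products $\lambda_e f_e(a)$ ($e\in E$) are nonzero and $\sum_{e\in E}\lambda_e f_e(a)=0$. 2. $M$ is signable. That is, there are functions $c_o\colon o\to\{1,-1\}$, one for each circuit $o$ of $M$, and functions $d_b\colon b\to\{1,-1\}$, one for each cocircuit $b$ of $M$, such that $\sum_{e\in o\cap b}c_o(e)\,d_b(e)=0$ in $\mathbb{Z}$ for every circuit $o$ and every cocircuit $b$. 3. Every finite minor of $M$ is regular, where a finite matroid is regular if it is represented over $\mathbb{R}$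 by a totally unimodular matrix, i.e. if there is a totally unimodular real matrix whose columns are indexed by its ground set such that a set is independent if and only if the columns it indexes are linearly independent. -/

import Mathlib

universe u w

namespace Matroid

/-- A matroid is tame if every intersection of a circuit with a cocircuit is finite. -/
def IsTame {α : Type u} (M : Matroid α) : Prop :=
  ∀ o b : Set α, M.IsCircuit o → M.IsCocircuit b → (o ∩ b).Finite

/-- The family `c` of scalars is a thin dependence of the family `f` of functions from `A` to `k`:
for each `a : A`, the sum `∑ e, c e * f e a` has only finitely many nonzero summands, and
its value is zero. -/
def IsThinDependence {E A k : Type*} [Field k] (f : E → A → k) (c : E → k) : Prop :=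
  ∀ a : A, (Function.support fun e => c e * f e a).Finite ∧ ∑ᶠ e, c e * f e a = 0

/-- The set `I` is thinly independent for `f`: the only thin dependence of `f` that vanishes
everywhere outside `I` is zero. -/
def IsThinIndep {E A k : Type*} [Field k] (f : E → A → k) (I : Set E) : Prop :=
  ∀ c : E → k, IsThinDependence f c → (∀ e, e ∉ I → c e = 0) → c = 0

/-- `M` is a thin sums matroid over the field `k`: for some set `A` and some family of
functions from `A` to `k` indexed by the ground set, the independent sets of `M` are exactly the
thinly independent sets. The universe of `A` is no restriction: repeated elements of `A` (those
with the same values `f e a` for all `e`) can be identified, after which `A` embeds into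
`M.E → k`. -/
def IsThinSums {α : Type u} (M : Matroid α) (k : Type w) [Field k] : Prop :=
  ∃ (A : Type (max u w)) (f : M.E → A → k),
    ∀ I : Set M.E, M.Indep (Subtype.val '' I) ↔ IsThinIndep f I

/-- `M` has a signing: functions `c o : o → {1, -1}`, one for each circuit `o`, and
`d b : b → {1, -1}`, one for each cocircuit `b`, such that for each circuit `o` and
cocircuit `b` the sum of `c o e * d b e` over `e ∈ o ∩ b`, taken in `ℤ`, is well defined (has only
finitely many nonzero summands; all summands are nonzero here) and equals zero.
The group `ℤˣ` is `{1, -1}`. Each function is extended arbitrarily to all of `α`, and values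
at sets that are not (co)circuits are never used. -/
def IsSignable {α : Type u} (M : Matroid α) : Prop :=
  ∃ c d : Set α → α → ℤˣ, ∀ o b : Set α, M.IsCircuit o → M.IsCocircuit b →
    (o ∩ b).Finite ∧ ∑ᶠ e ∈ o ∩ b, (c o e : ℤ) * (d b e : ℤ) = 0

/-- A (finite) matroid is regular if it is represented over the reals by a totally unimodular
matrix: the columns are indexed by the ground set, and a set is independent exactly if the
columns that it indexes are linearly independent. -/
def IsRegular {α : Type u} (N : Matroid α) : Prop :=
  ∃ (r : ℕ) (A : Matrix (Fin r) N.E ℝ), A.IsTotallyUnimodular ∧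
    ∀ I : Set N.E, N.Indep (Subtype.val '' I) ↔
      LinearIndependent ℝ (fun e : I => fun i : Fin r => A i e)

end Matroid

/-! The bridge between the three conditions is `IsPaintable`: vectors over `k` whose supports are
exactly the circuits and cocircuits, with every circuit vector orthogonal to every cocircuit vector.
A signing, cast into `k`, is such a system over every field, and the cocircuit vectors of such a
system form a thin sums representation (`IsPaintable.isThinSums`).

Conversely, a tame thin sums matroid is paintable (`ThinRep.isPaintable`). Circuit vectors are thin
dependences. By tameness their restrictions to a cocircuit are finitely supported, so a cocircuit
vector can be found as a linear functional. The obstruction would be a thin dependence meeting the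
cocircuit in one element; `ThinRep.exists_isCircuit` would turn it into a circuit doing the same.

Paintability passes to minors, so finite minors are representable over the fields with two and three
elements. Standard representations over both, for one base, have the same zero pattern and the same
vanishing minors, so lifting the ternary one to entries 0, 1, -1 gives a totally unimodular matrix
(`IsPaintable.isRegular`).

Finite regular matroids are signable, since kernel vectors on circuits and rows of standard forms
have entries 0, 1, -1 after scaling. Compactness extends this to tame matroids: finitely many
circuits and cocircuits keep their intersections in a suitable finite minor
(`IsTame.exists_finite_minor`). -/

open Function

/-! ### Thin sums representations and orthogonal vectors on circuits and cocircuits -/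

namespace Matroid

variable {α : Type u} {M N : Matroid α} {k : Type*} [Field k]

/-- Scalars on circuits and cocircuits, nonzero exactly on the (co)circuit, such that circuits and
cocircuits are orthogonal. -/
def IsPaintable (M : Matroid α) (k : Type*) [Field k] : Prop :=
  ∃ c d : Set α → α → k, (∀ o, M.IsCircuit o → support (c o) = o) ∧
    (∀ b, M.IsCocircuit b → support (d b) = b) ∧
    ∀ o b, M.IsCircuit o → M.IsCocircuit b → (o ∩ b).Finite ∧ ∑ᶠ e, c o e * d b e = 0

/-- The space of thin dependences. -/
def thinDependences {E A : Type*} (f : E → A → k) : Submodule k (E → k) where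
  carrier := {c | IsThinDependence f c}
  add_mem' {c d} hc hd a := by
    have h : (fun e => (c + d) e * f e a) = fun e => c e * f e a + d e * f e a := by
      ext e; simp [add_mul]
    rw [h]
    refine ⟨((hc a).1.union (hd a).1).subset (support_add _ _), ?_⟩
    rw [finsum_add_distrib (hc a).1 (hd a).1, (hc a).2, (hd a).2, add_zero]
  zero_mem' a := by simp
  smul_mem' r c hc a := by
    have h : (fun e => (r • c) e * f e a) = fun e => r * (c e * f e a) := by
      ext e; simp [mul_assoc]
    rw [h]
    refine ⟨(hc a).1.subset (support_mul_subset_right (fun _ => r) _), ?_⟩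
    rw [← mul_finsum _ _, (hc a).2, mul_zero]

lemma mem_thinDependences {E A : Type*} {f : E → A → k} {c : E → k} :
    c ∈ thinDependences f ↔ IsThinDependence f c := Iff.rfl

/-- `f` represents `M` by thin independence, where `f` is defined on the whole type. -/
def ThinRep {A : Type*} (M : Matroid α) (f : α → A → k) : Prop :=
  ∀ I ⊆ M.E, M.Indep I ↔ ∀ v ∈ thinDependences f, support v ⊆ I → v = 0

lemma isThinDependence_comp_val {A : Type*} {E : Set α} {f : α → A → k} {v : α → k}
    (hv : support v ⊆ E) :
    IsThinDependence (fun e : E => f e) (fun e : E => v e) ↔ IsThinDependence f v := by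
  refine forall_congr' fun a => ?_
  have hs : support (fun e => v e * f e a) ⊆ E := (support_mul_subset_left _ _).trans hv
  have h1 : ∑ᶠ e : E, v e * f e a = ∑ᶠ e, v e * f e a := by
    rw [finsum_set_coe_eq_finsum_mem (f := fun e => v e * f e a) E]
    rw [finsum_mem_def]
    rw [Set.indicator_eq_self.2 hs]
  have h2 : (support fun e : E => v e * f e a) = Subtype.val ⁻¹' support (fun e => v e * f e a) :=
    rfl
  rw [h1, h2]
  refine and_congr_left fun _ => ⟨fun h => ?_, fun h => h.preimage Subtype.val_injective.injOn⟩
  refine (h.image Subtype.val).subset fun e he => ⟨⟨e, hs he⟩, he, rfl⟩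

lemma thinRep_iff {A : Type*} {f : α → A → k} :
    M.ThinRep f ↔ ∀ I : Set M.E, M.Indep (Subtype.val '' I) ↔
      IsThinIndep (fun e : M.E => f e) I := by
  classical
  have key (I : Set M.E) : IsThinIndep (fun e : M.E => f e) I ↔
      ∀ v ∈ thinDependences f, support v ⊆ Subtype.val '' I → v = 0 := by
    constructor
    · intro h v hv hvI
      have hvE : support v ⊆ M.E := hvI.trans (by simp)
      have h0 := h (fun e => v e) ((isThinDependence_comp_val hvE).2 hv) fun e he => by
        by_contra h0
        obtain ⟨x, hx, hxe⟩ := hvI h0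
        exact he (Subtype.ext hxe ▸ hx)
      ext e
      by_contra he
      exact he (congrFun h0 ⟨e, hvE he⟩)
    · intro h c hc hcI
      have hs : support (extend Subtype.val c 0) ⊆ Subtype.val '' I := by
        intro e he
        by_cases heE : e ∈ M.E
        · refine ⟨⟨e, heE⟩, by_contra fun hI => he ?_, rfl⟩
          have := Subtype.val_injective.extend_apply c 0 (⟨e, heE⟩ : M.E)
          rw [this, hcI _ hI]
        · exact absurd (extend_apply' c (0 : α → k) e fun ⟨x, hx⟩ => heE (hx ▸ x.2)) he
      have hr : (fun e : M.E => extend Subtype.val c (0 : α → k) e) = c := by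
        ext e; exact Subtype.val_injective.extend_apply c 0 e
      have h0 := h (extend Subtype.val c 0) (by
        rw [mem_thinDependences, ← isThinDependence_comp_val (hs.trans (by simp : _ ⊆ M.E)), hr]
        exact hc) hs
      rw [← hr, h0]; rfl
  constructor
  · intro h I
    rw [key, h _ (by simp)]
  · intro h I hI
    have := h (Subtype.val ⁻¹' I)
    rwa [key, Subtype.image_preimage_val, Set.inter_eq_self_of_subset_right hI] at this

lemma ThinRep.exists_support_eq {A : Type*} {f : α → A → k} (hf : M.ThinRep f) {o : Set α}
    (ho : M.IsCircuit o) : ∃ v ∈ thinDependences f, support v = o := by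
  have h := ho.not_indep
  rw [hf _ ho.subset_ground] at h
  push Not at h
  obtain ⟨v, hv, hvo, hv0⟩ := h
  refine ⟨v, hv, ho.eq_of_not_indep_subset (fun hi => hv0 ?_) hvo⟩
  exact (hf _ (hvo.trans ho.subset_ground)).1 hi v hv subset_rfl

/-- In a thin sums matroid, each element of the support of a thin dependence lies in a circuit
inside that support. -/
lemma ThinRep.exists_isCircuit {A : Type*} {f : α → A → k} (hf : M.ThinRep f) {v : α → k}
    (hv : v ∈ thinDependences f) (hvE : support v ⊆ M.E) {e : α} (he : v e ≠ 0) :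
    ∃ o, M.IsCircuit o ∧ e ∈ o ∧ o ⊆ support v := by
  classical
  set X := support v with hX
  by_contra hcon
  have hecl : e ∉ M.closure (X \ {e}) := fun h => by
    obtain ⟨C, hC, hCc, heC⟩ := exists_isCircuit_of_mem_closure h (by simp)
    exact hcon ⟨C, hCc, heC, hC.trans (Set.insert_subset he Set.sdiff_subset)⟩
  obtain ⟨I, hI⟩ := M.exists_isBasis (X \ {e}) (Set.sdiff_subset.trans hvE)
  have heI : e ∉ I := fun h => (hI.subset h).2 rfl
  have hIe : M.Indep (insert e I) := by
    rw [hI.indep.insert_indep_iff_of_notMem heI]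
    exact ⟨hvE he, by rwa [hI.closure_eq_closure]⟩
  have hIX : insert e I ⊆ X := Set.insert_subset he (hI.subset.trans Set.sdiff_subset)
  -- any finite set of values outside `insert e I` can be cleared
  have clear (T : Finset α) : ∃ u ∈ thinDependences f, support u ⊆ X ∧ u e ≠ 0 ∧
      ∀ x ∈ T, x ∉ insert e I → u x = 0 := by
    induction T using Finset.induction_on with
    | empty => exact ⟨v, hv, subset_rfl, he, by simp⟩
    | insert x T hxT ih =>
      obtain ⟨u, hu, huX, hue, huT⟩ := ih
      by_cases hx : u x = 0 ∨ x ∈ insert e I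
      · refine ⟨u, hu, huX, hue, fun y hy hyI => ?_⟩
        obtain rfl | hy := Finset.mem_insert.1 hy
        · exact hx.resolve_right hyI
        · exact huT y hy hyI
      push Not at hx
      have hxe : x ≠ e := fun h => hx.2 (by simp [h])
      have hxI : x ∉ I := fun h => hx.2 (by simp [h])
      have hxcl : x ∈ M.closure I := by
        rw [hI.closure_eq_closure]
        exact M.mem_closure_of_mem ⟨huX hx.1, hxe⟩ (Set.sdiff_subset.trans hvE)
      obtain ⟨c, hc, hco⟩ := hf.exists_support_eq (hI.indep.fundCircuit_isCircuit hxcl hxI)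
      have hcs : support c ⊆ insert x I := hco ▸ M.fundCircuit_subset_insert x I
      have hcx : c x ≠ 0 := by
        have : x ∈ support c := hco ▸ M.mem_fundCircuit x I
        exact this
      have hc0 (y) (hyx : y ≠ x) (hyI : y ∉ I) : c y = 0 := by
        by_contra h
        exact (hcs h).elim hyx hyI
      -- `c` lives on `insert x I`, so outside `I` only the value at `x` changes; in particular the
      -- value at `e` survives.
      refine ⟨u - (u x / c x) • c, sub_mem hu (Submodule.smul_mem _ _ hc), ?_, ?_, ?_⟩
      · intro y hy
        by_contra hyX
        refine hy ?_
        have h1 : u y = 0 := by_contra fun h => hyX (huX h)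
        have h2 : c y = 0 := hc0 y (fun h => hyX (h ▸ huX hx.1))
          fun h => hyX (hIX (Set.mem_insert_of_mem _ h))
        simp [h1, h2]
      · simpa [hc0 e hxe.symm heI] using hue
      · intro y hy hyI
        by_cases hyx : y = x
        · subst hyx; simp [hcx]
        · have hyI' : y ∉ I := fun h => hyI (by simp [h])
          simp [hc0 y hyx hyI', huT y ((Finset.mem_insert.1 hy).resolve_left hyx) hyI]
  -- `v` has no zero on `X`, so its thinness at `a` bounds the support of `f · a` on `X`.
  have hfin (a : A) : (support fun x => if x ∈ X then f x a else 0).Finite :=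
    (hv a).1.subset fun x hx => by
      simp only [mem_support, ne_eq, ite_eq_right_iff, Classical.not_imp] at hx
      exact mul_ne_zero hx.1 hx.2
  let φ (a : A) : α →₀ k := Finsupp.ofSupportFinite _ (hfin a)
  have hφx (a x) : φ a x = if x ∈ X then f x a else 0 := rfl
  have hφ (u : α → k) (hu : support u ⊆ X) (a : A) :
      (support fun x => u x * f x a).Finite ∧
      Finsupp.linearCombination k u (φ a) = ∑ᶠ x, u x * f x a := by
    have h1 : (support fun x => u x * f x a) ⊆ (φ a).support := by
      intro x hx
      have hxX : x ∈ X := hu (left_ne_zero_of_mul hx)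
      simp [hφx, hxX, right_ne_zero_of_mul hx]
    refine ⟨(φ a).support.finite_toSet.subset h1, ?_⟩
    rw [finsum_eq_sum_of_support_subset _ h1, Finsupp.linearCombination_apply, Finsupp.sum]
    refine Finset.sum_congr rfl fun x hx => ?_
    have hxX : x ∈ X := by
      by_contra h
      simp [hφx, h] at hx
    simp [hφx, hxX, mul_comm]
  let P : Submodule k (α →₀ k) := Submodule.span k
    (Set.range φ ∪ (fun x => Finsupp.single x 1) '' (insert e I)ᶜ)
  -- An element of `P` involves only finitely many coordinate conditions, so a dependence cleared at
  -- finitely many places already annihilates it. Hence `single e 1` is not in `P`, and a functional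
  -- that separates them clears all places at once.
  have hP : ∀ p ∈ P, ∃ T : Finset α, ∀ u ∈ thinDependences f, support u ⊆ X →
      (∀ x ∈ T, x ∉ insert e I → u x = 0) → Finsupp.linearCombination k u p = 0 := by
    intro p hp
    induction hp using Submodule.span_induction with
    | mem p hp =>
      obtain ⟨a, rfl⟩ | ⟨x, hx, rfl⟩ := hp
      · exact ⟨∅, fun u hu huX _ => by rw [(hφ u huX a).2, (hu a).2]⟩
      · exact ⟨{x}, fun u _ _ h => by simpa using h x (by simp) hx⟩
    | zero => exact ⟨∅, by simp⟩
    | add p q _ _ hp hq =>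
      obtain ⟨S, hS⟩ := hp
      obtain ⟨T, hT⟩ := hq
      refine ⟨S ∪ T, fun u hu huX h => ?_⟩
      rw [map_add, hS u hu huX fun x hx => h x (Finset.mem_union_left _ hx),
        hT u hu huX fun x hx => h x (Finset.mem_union_right _ hx), add_zero]
    | smul r p _ hp =>
      obtain ⟨T, hT⟩ := hp
      exact ⟨T, fun u hu huX h => by rw [map_smul, hT u hu huX h, smul_zero]⟩
  have heP : Finsupp.single e 1 ∉ P := fun h => by
    obtain ⟨T, hT⟩ := hP _ h
    obtain ⟨u, hu, huX, hue, huT⟩ := clear T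
    exact hue (by simpa using hT u hu huX huT)
  obtain ⟨W, hWe, hWP⟩ := Submodule.exists_le_ker_of_notMem heP
  have hW : W = Finsupp.linearCombination k fun x => W (Finsupp.single x 1) := by
    ext x; simp
  set w : α → k := fun x => W (Finsupp.single x 1) with hw
  have hwI : support w ⊆ insert e I := fun x hx => by_contra fun hxI =>
    hx (hWP (Submodule.subset_span (Or.inr ⟨x, hxI, rfl⟩)))
  have hwV : w ∈ thinDependences f := fun a => by
    have h1 := hφ w (hwI.trans hIX) a
    refine ⟨h1.1, ?_⟩
    rw [← h1.2, ← hW]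
    exact hWP (Submodule.subset_span (Or.inl ⟨a, rfl⟩))
  exact hWe (congrFun ((hf _ (hIX.trans hvE)).1 hIe w hwV hwI) e)

/-- Since `o \ {f}` is independent, some cocircuit meets it in `e` alone; a circuit and a cocircuit
never meet in exactly one element, so `f` must be in it too. -/
lemma IsCircuit.exists_isCocircuit_inter_eq_pair {o : Set α} (ho : M.IsCircuit o) {e f : α}
    (he : e ∈ o) (hf : f ∈ o) (hef : f ≠ e) : ∃ b, M.IsCocircuit b ∧ o ∩ b = {e, f} := by
  obtain ⟨b, hb, hbe⟩ := (ho.sdiff_singleton_indep hf).exists_isCocircuit_inter_eq_mem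
    (e := e) ⟨he, hef.symm⟩
  have heb : e ∈ b := (hbe.symm.subset rfl).1
  have hsub : o ∩ b ⊆ {e, f} := by
    intro x hx
    by_cases hxf : x = f
    · simp [hxf]
    · exact Or.inl (hbe.subset ⟨hx.2, hx.1, hxf⟩)
  refine ⟨b, hb, hsub.antisymm ?_⟩
  obtain ⟨x, hx, hxe⟩ := (ho.isCocircuit_inter_nontrivial hb ⟨e, he, heb⟩).exists_ne e
  obtain rfl : x = f := (hsub hx).resolve_left hxe
  exact Set.insert_subset ⟨he, heb⟩ (Set.singleton_subset_iff.2 hx)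

lemma IsCocircuit.exists_isCircuit_inter_eq_pair {b : Set α} (hb : M.IsCocircuit b) {e f : α}
    (he : e ∈ b) (hf : f ∈ b) (hef : f ≠ e) : ∃ o, M.IsCircuit o ∧ o ∩ b = {e, f} := by
  obtain ⟨o, ho, h⟩ := hb.isCircuit.exists_isCocircuit_inter_eq_pair he hf hef
  exact ⟨o, by simpa using ho, by rwa [Set.inter_comm]⟩

/-- For a cocircuit `b` and `e ∈ b`, a functional vanishing on the traces of all circuit vectors on
`b`, but not on `single e 1`, supplies the cocircuit vector. -/
lemma ThinRep.isPaintable {A : Type*} {f : α → A → k} (hf : M.ThinRep f) (hM : M.IsTame) :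
    M.IsPaintable k := by
  classical
  choose! c hcV hco using fun o (ho : M.IsCircuit o) => hf.exists_support_eq ho
  have hd : ∀ b, M.IsCocircuit b → ∃ d : α → k, support d = b ∧
      ∀ o, M.IsCircuit o → ∑ᶠ e, c o e * d e = 0 := by
    intro b hb
    obtain ⟨e, he⟩ := hb.nonempty
    have hfin (o : Set α) (ho : M.IsCircuit o) :
        (support fun x => if x ∈ b then c o x else 0).Finite :=
      (hM o b ho hb).subset fun x hx => by
        simp only [mem_support, ne_eq, ite_eq_right_iff, Classical.not_imp] at hx
        exact ⟨hco o ho ▸ hx.2, hx.1⟩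
    let φ (o : {o // M.IsCircuit o}) : α →₀ k := Finsupp.ofSupportFinite _ (hfin o o.2)
    have hφx (o x) : φ o x = if x ∈ b then c o x else 0 := rfl
    have hP : ∀ p ∈ Submodule.span k (Set.range φ), ∃ v ∈ thinDependences f,
        support v ⊆ M.E ∧ ∀ x ∈ b, v x = p x := by
      intro p hp
      induction hp using Submodule.span_induction with
      | mem p hp =>
        obtain ⟨o, rfl⟩ := hp
        refine ⟨c o, hcV o o.2, (hco o o.2).subset.trans o.2.subset_ground, fun x hx => ?_⟩
        simp [hφx, hx]
      | zero => exact ⟨0, zero_mem _, by simp, by simp⟩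
      | add p q _ _ hp hq =>
        obtain ⟨v, hv, hvE, hvb⟩ := hp
        obtain ⟨w, hw, hwE, hwb⟩ := hq
        refine ⟨v + w, add_mem hv hw, (support_add _ _).trans (Set.union_subset hvE hwE),
          fun x hx => ?_⟩
        simp [hvb x hx, hwb x hx]
      | smul r p _ hp =>
        obtain ⟨v, hv, hvE, hvb⟩ := hp
        refine ⟨r • v, Submodule.smul_mem _ _ hv, (support_const_smul_subset _ _).trans hvE,
          fun x hx => ?_⟩
        simp [hvb x hx]
    -- Otherwise some thin dependence meets `b` in `e` alone, and so does a circuit inside its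
    -- support.
    have heP : Finsupp.single e 1 ∉ Submodule.span k (Set.range φ) := fun h => by
      obtain ⟨v, hv, hvE, hvb⟩ := hP _ h
      obtain ⟨o, ho, heo, hov⟩ := hf.exists_isCircuit hv hvE (e := e) (by simp [hvb e he])
      refine ho.inter_isCocircuit_ne_singleton hb (e := e) (Set.Subset.antisymm ?_ ?_)
      · rintro x ⟨hxo, hxb⟩
        by_contra hxe
        refine hov hxo ?_
        rw [hvb x hxb, Finsupp.single_eq_of_ne hxe]
      · simp [heo, he]
    obtain ⟨W, hWe, hWP⟩ := Submodule.exists_le_ker_of_notMem heP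
    have hW : W = Finsupp.linearCombination k fun x => W (Finsupp.single x 1) := by
      ext x; simp
    set d : α → k := fun x => if x ∈ b then W (Finsupp.single x 1) else 0 with hd
    have hdb : support d ⊆ b := fun x hx => by_contra fun h => hx (by simp [hd, h])
    have horth : ∀ o, M.IsCircuit o → ∑ᶠ x, c o x * d x = 0 := by
      intro o ho
      have h0 : W (φ ⟨o, ho⟩) = 0 := hWP (Submodule.subset_span ⟨_, rfl⟩)
      have hs : (support fun x => c o x * d x) ⊆ (φ ⟨o, ho⟩).support := by
        intro x hx
        have hxb : x ∈ b := hdb (right_ne_zero_of_mul hx)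
        simp [hφx, hxb, left_ne_zero_of_mul hx]
      rw [finsum_eq_sum_of_support_subset _ hs, ← h0, hW, Finsupp.linearCombination_apply,
        Finsupp.sum]
      refine Finset.sum_congr rfl fun x hx => ?_
      have hxb : x ∈ b := by
        by_contra h
        simp [hφx, h] at hx
      simp [hφx, hxb, hd]
    have hde : d e ≠ 0 := by simpa [hd, he] using hWe
    refine ⟨d, hdb.antisymm fun x hx => ?_, horth⟩
    by_cases hxe : x = e
    · exact hxe ▸ hde
    -- Orthogonality to a circuit meeting `b` in `{e, x}` makes `d x` nonzero because `d e` is, so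
    -- the support is all of `b`.
    obtain ⟨o, ho, hob⟩ := hb.exists_isCircuit_inter_eq_pair he hx hxe
    have h := horth o ho
    have hs : (support fun y => c o y * d y) ⊆ ({e, x} : Finset α) := by
      intro y hy
      have : y ∈ o ∩ b := ⟨hco o ho ▸ left_ne_zero_of_mul hy, hdb (right_ne_zero_of_mul hy)⟩
      simpa [hob] using this
    rw [finsum_eq_sum_of_support_subset _ hs, Finset.sum_pair (Ne.symm hxe)] at h
    intro hdx
    rw [hdx, mul_zero, add_zero] at h
    have heo : e ∈ support (c o) := by
      rw [hco o ho]
      exact (hob.symm.subset (by simp : e ∈ ({e, x} : Set α))).1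
    exact mul_ne_zero heo hde h
  choose! d hdb hdo using hd
  exact ⟨c, d, hco, hdb, fun o b ho hb => ⟨hM o b ho hb, hdo b hb o ho⟩⟩

lemma IsThinSums.isPaintable {k : Type w} [Field k] (h : M.IsThinSums k) (hM : M.IsTame) :
    M.IsPaintable k := by
  classical
  obtain ⟨A, f, hf⟩ := h
  let g : α → A → k := fun e => if he : e ∈ M.E then f ⟨e, he⟩ else 0
  have hg : (fun e : M.E => g e) = f := by ext e a; simp [g]
  refine ThinRep.isPaintable (f := g) (thinRep_iff.2 ?_) hM
  rwa [hg]

/-- The cocircuits serve as the index set `A`. For independent `I`, each element of `I` is the only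
one in some cocircuit, whose coordinate forces its coefficient to vanish; for dependent `I`, a
circuit vector is a nonzero dependence. -/
lemma IsPaintable.isThinSums {k : Type w} [Field k] (h : M.IsPaintable k) : M.IsThinSums k := by
  obtain ⟨c, d, hc, hd, h⟩ := h
  let f : α → ULift.{w} {b // M.IsCocircuit b} → k := fun e b => d b.down e
  refine ⟨_, fun e => f e, thinRep_iff.1 fun I hI => ⟨fun hi v hv hvI => ?_, fun hi => ?_⟩⟩
  · ext e
    by_contra he
    obtain ⟨b, hb, hbI⟩ := hi.exists_isCocircuit_inter_eq_mem (hvI he)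
    have heb : e ∈ b := (hbI.symm.subset rfl).1
    have h1 := (hv ⟨b, hb⟩).2
    rw [finsum_eq_single _ e] at h1
    · have : e ∈ support (d b) := by rwa [hd b hb]
      exact mul_ne_zero he this h1
    · intro x hx
      by_contra h0
      have hxb : x ∈ b := hd b hb ▸ (right_ne_zero_of_mul h0 : d b x ≠ 0)
      exact hx (hbI.subset ⟨hxb, hvI (left_ne_zero_of_mul h0)⟩)
  · rw [indep_iff_forall_subset_not_isCircuit hI]
    intro o hoI ho
    have h0 : c o = 0 := hi (c o) (fun b => ⟨?_, (h o b.down ho b.down.2).2⟩) ((hc o ho).subset.trans hoI)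
    · have := hc o ho
      rw [h0] at this
      simp only [support_zero] at this
      exact ho.nonempty.ne_empty this.symm
    · refine (h o b.down ho b.down.2).1.subset fun x hx => ⟨?_, ?_⟩
      · exact hc o ho ▸ left_ne_zero_of_mul hx
      · exact hd b.down b.down.2 ▸ (right_ne_zero_of_mul hx : d b.down x ≠ 0)

/-! ### Change of field and passage to minors -/

lemma IsSignable.isPaintable (h : M.IsSignable) (k : Type*) [Field k] : M.IsPaintable k := by
  classical
  obtain ⟨c, d, h⟩ := h
  have hu (z : ℤˣ) : ((z : ℤ) : k) ≠ 0 := by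
    obtain rfl | rfl := Int.units_eq_one_or z <;> simp
  refine ⟨fun o e => if e ∈ o then ((c o e : ℤ) : k) else 0,
    fun b e => if e ∈ b then ((d b e : ℤ) : k) else 0, fun o _ => ?_, fun b _ => ?_,
    fun o b ho hb => ⟨(h o b ho hb).1, ?_⟩⟩
  · ext e; simp [hu]
  · ext e; simp [hu]
  · obtain ⟨hfin, h0⟩ := h o b ho hb
    rw [finsum_mem_eq_finite_toFinset_sum _ hfin] at h0
    rw [finsum_eq_sum_of_support_subset (s := hfin.toFinset)]
    · rw [← Int.cast_zero (R := k), ← h0, Int.cast_sum]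
      refine Finset.sum_congr rfl fun e he => ?_
      rw [Set.Finite.mem_toFinset] at he
      simp [he.1, he.2]
    · intro e he
      simp only [mem_support, ne_eq, mul_eq_zero, not_or] at he
      rw [Set.Finite.coe_toFinset]
      exact ⟨by_contra fun h => he.1 (by simp [h]), by_contra fun h => he.2 (by simp [h])⟩

lemma IsPaintable.map {k' : Type*} [Field k'] (h : M.IsPaintable k) (φ : k →+* k') :
    M.IsPaintable k' := by
  obtain ⟨c, d, hc, hd, h⟩ := h
  refine ⟨fun o e => φ (c o e), fun b e => φ (d b e), fun o ho => ?_, fun b hb => ?_,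
    fun o b ho hb => ⟨(h o b ho hb).1, ?_⟩⟩
  · refine Eq.trans ?_ (hc o ho); ext e; simp
  · refine Eq.trans ?_ (hd b hb); ext e; simp
  · simp_rw [← map_mul]
    have := φ.toAddMonoidHom.map_finsum (f := fun e => c o e * d b e)
      ((h o b ho hb).1.subset fun e he => ⟨hc o ho ▸ left_ne_zero_of_mul he,
        hd b hb ▸ right_ne_zero_of_mul he⟩)
    rw [(h o b ho hb).2, map_zero] at this
    exact this.symm

/-- Circuits and cocircuits of a minor extend to the matroid with unchanged intersections. -/
lemma IsMinor.exists_extension (h : N ≤m M) : ∃ φ ψ : Set α → Set α,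
    (∀ o, N.IsCircuit o → M.IsCircuit (φ o) ∧ o ⊆ φ o) ∧
    (∀ b, N.IsCocircuit b → M.IsCocircuit (ψ b) ∧ b ⊆ ψ b) ∧
    ∀ o b, N.IsCircuit o → N.IsCocircuit b → φ o ∩ ψ b = o ∩ b := by
  obtain ⟨C, D, rfl⟩ := h
  have h1 : ∀ o, (M ／ C ＼ D).IsCircuit o → ∃ o', M.IsCircuit o' ∧ o ⊆ o' ∧ o' ⊆ o ∪ C :=
    fun o ho => by
      obtain ⟨o', h1, h2, h3⟩ := ho.of_delete.exists_subset_isCircuit_of_contract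
      exact ⟨o', h1, h2, h3⟩
  have h2 : ∀ b, (M ／ C ＼ D).IsCocircuit b →
      ∃ b', M.IsCocircuit b' ∧ b ⊆ b' ∧ b' ⊆ b ∪ D ∧ Disjoint b' C := fun b hb => by
    -- Dually, `D` is contracted and `C` deleted, so the extended cocircuit gains only elements of
    -- `D` and avoids `C`.
    rw [isCocircuit_def, dual_contract_delete] at hb
    obtain ⟨b', h1, h2, h3⟩ := hb.exists_subset_isCircuit_of_contract
    rw [delete_isCircuit_iff] at h1
    exact ⟨b', h1.1, h2, h3, h1.2⟩
  choose! φ hφ1 hφ2 hφ3 using h1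
  choose! ψ hψ1 hψ2 hψ3 hψ4 using h2
  refine ⟨φ, ψ, fun o ho => ⟨hφ1 o ho, hφ2 o ho⟩, fun b hb => ⟨hψ1 b hb, hψ2 b hb⟩,
    fun o b ho hb => Set.Subset.antisymm ?_ (Set.inter_subset_inter (hφ2 o ho) (hψ2 b hb))⟩
  rintro x ⟨hxo, hxb⟩
  have hxo' : x ∈ o := (hφ3 o ho hxo).resolve_right (Set.disjoint_left.1 (hψ4 b hb) hxb)
  exact ⟨hxo', (hψ3 b hb hxb).resolve_right (ho.subset_ground hxo').2⟩

lemma IsPaintable.of_isMinor (h : M.IsPaintable k) (hN : N ≤m M) : N.IsPaintable k := by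
  classical
  obtain ⟨c, d, hc, hd, h⟩ := h
  obtain ⟨φ, ψ, hφ, hψ, hφψ⟩ := hN.exists_extension
  refine ⟨fun o e => if e ∈ o then c (φ o) e else 0, fun b e => if e ∈ b then d (ψ b) e else 0,
    fun o ho => ?_, fun b hb => ?_, fun o b ho hb => ?_⟩
  · ext e
    have := hc _ (hφ o ho).1
    simp only [mem_support, ne_eq, ite_eq_right_iff, Classical.not_imp, and_iff_left_iff_imp]
    intro he
    exact this.symm.subset ((hφ o ho).2 he)
  · ext e
    have := hd _ (hψ b hb).1
    simp only [mem_support, ne_eq, ite_eq_right_iff, Classical.not_imp, and_iff_left_iff_imp]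
    intro he
    exact this.symm.subset ((hψ b hb).2 he)
  · obtain ⟨h1, h2⟩ := h _ _ (hφ o ho).1 (hψ b hb).1
    refine ⟨hφψ o b ho hb ▸ h1, ?_⟩
    refine Eq.trans (finsum_congr fun e => ?_) h2
    by_cases he : e ∈ o ∩ b
    · simp [he.1, he.2]
    · have h3 : c (φ o) e * d (ψ b) e = 0 := by
        by_contra h0
        refine he (hφψ o b ho hb ▸ ⟨?_, ?_⟩)
        · exact (hc _ (hφ o ho).1).subset (left_ne_zero_of_mul h0)
        · exact (hd _ (hψ b hb).1).subset (right_ne_zero_of_mul h0)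
      rw [h3]
      by_cases heo : e ∈ o
      · have heb : e ∉ b := fun h => he ⟨heo, h⟩
        simp [heb]
      · simp [heo]

end Matroid

/-! ### Totally unimodular matrices and minors -/

namespace Matrix

lemma mem_range_signType_cast_iff {R : Type*} [Ring R] {x : R} :
    x ∈ Set.range (SignType.cast : SignType → R) ↔ x = 0 ∨ x = -1 ∨ x = 1 := by
  constructor
  · rintro ⟨s, rfl⟩
    cases s <;> simp
  · rintro (rfl | rfl | rfl)
    exacts [⟨0, by simp⟩, ⟨-1, by simp⟩, ⟨1, by simp⟩]

/-- Pivoting on an entry `1` or `-1`. -/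
lemma det_eq_mul_det_schur {n : ℕ} {R : Type*} [CommRing R]
    (W : Matrix (Fin (n + 1)) (Fin (n + 1)) R) (h : W 0 0 * W 0 0 = 1) :
    W.det = W 0 0 * (of fun i j : Fin n =>
      W i.succ j.succ - W i.succ 0 * W 0 0 * W 0 j.succ).det := by
  -- Row operations clear the first column below the pivot, which is its own inverse.
  set V : Matrix (Fin (n + 1)) (Fin (n + 1)) R := of (Fin.cons (W 0) fun i j =>
    W i.succ j - W i.succ 0 * W 0 0 * W 0 j) with hV
  have hWV : W.det = V.det := by
    refine det_eq_of_forall_row_eq_smul_add_const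
      (Fin.cons 0 fun i => W i.succ 0 * W 0 0) 0 rfl fun i j => ?_
    refine Fin.cases ?_ (fun i => ?_) i
    · simp [hV]
    · simp [hV]
  have hsucc (i : Fin n) : V i.succ 0 = 0 := by
    simp [hV, mul_assoc, h]
  rw [hWV, det_succ_column_zero, Fin.sum_univ_succ]
  simp only [hsucc]
  simp only [mul_zero, zero_mul, Finset.sum_const_zero, add_zero, Fin.val_zero, pow_zero, one_mul]
  congr 2

/-- A square integer matrix with entries `0`, `1`, `-1` all of whose minors vanish modulo `2`
exactly when they vanish modulo `3` has determinant `0`, `1` or `-1`. -/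
lemma det_mem_range_of_two_dvd_iff_three_dvd {n : ℕ} (Z : Matrix (Fin n) (Fin n) ℤ)
    (h1 : ∀ i j, Z i j ∈ Set.range SignType.cast)
    (h : ∀ (m : ℕ) (f g : Fin m → Fin n),
      2 ∣ (Z.submatrix f g).det ↔ 3 ∣ (Z.submatrix f g).det) :
    Z.det ∈ Set.range SignType.cast := by
  induction n with
  | zero => exact ⟨1, by simp⟩
  | succ n ih =>
    by_cases hZ : ∀ j, Z 0 j = 0
    · exact ⟨0, by simp [det_eq_zero_of_row_eq_zero 0 hZ]⟩
    push Not at hZ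
    obtain ⟨j, hj⟩ := hZ
    set W := Z.submatrix id (Equiv.swap 0 j) with hW
    have hsq : W 0 0 * W 0 0 = 1 := by
      have h2 := h1 0 j
      simp only [mem_range_signType_cast_iff] at h2
      simp only [hW, submatrix_apply, id, Equiv.swap_apply_left]
      obtain h2 | h2 | h2 := h2 <;> simp_all
    have hpm : W 0 0 = 1 ∨ W 0 0 = -1 := mul_self_eq_one_iff.1 hsq
    have hneg (x : ℤ) : -x ∈ Set.range (SignType.cast : SignType → ℤ) ↔
        x ∈ Set.range (SignType.cast : SignType → ℤ) := by
      simp only [mem_range_signType_cast_iff]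
      omega
    have hdet : W.det ∈ Set.range SignType.cast → Z.det ∈ Set.range SignType.cast := by
      intro hWd
      rw [hW, det_permute'] at hWd
      obtain hs | hs := Int.units_eq_one_or (Equiv.Perm.sign (Equiv.swap 0 j)) <;>
        simpa [hs, hneg] using hWd
    apply hdet
    rw [det_eq_mul_det_schur W hsq]
    set S : Matrix (Fin n) (Fin n) ℤ := of fun i j =>
      W i.succ j.succ - W i.succ 0 * W 0 0 * W 0 j.succ with hS
    have hSsub : ∀ (m : ℕ) (f g : Fin m → Fin n),
        2 ∣ (S.submatrix f g).det ↔ 3 ∣ (S.submatrix f g).det := by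
      intro m f g
      -- A minor of the Schur complement is, up to the sign of the pivot, the minor of `W` with the
      -- pivot row and column added.
      have h3 := det_eq_mul_det_schur (W.submatrix
        (Fin.cons 0 (Fin.succ ∘ f) : Fin (m + 1) → Fin (n + 1))
        (Fin.cons 0 (Fin.succ ∘ g) : Fin (m + 1) → Fin (n + 1))) (by simpa using hsq)
      have h4 := h (m + 1) (Fin.cons 0 (Fin.succ ∘ f))
        (Equiv.swap 0 j ∘ (Fin.cons 0 (Fin.succ ∘ g) : Fin (m + 1) → Fin (n + 1)))
      have h5 : Z.submatrix (Fin.cons 0 (Fin.succ ∘ f) : Fin (m + 1) → Fin (n + 1))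
        (Equiv.swap 0 j ∘ (Fin.cons 0 (Fin.succ ∘ g) : Fin (m + 1) → Fin (n + 1))) =
        W.submatrix (Fin.cons 0 (Fin.succ ∘ f) : Fin (m + 1) → Fin (n + 1))
        (Fin.cons 0 (Fin.succ ∘ g) : Fin (m + 1) → Fin (n + 1)) := rfl
      have h6 : (S.submatrix f g) = of fun i j : Fin m =>
        (W.submatrix (Fin.cons 0 (Fin.succ ∘ f) : Fin (m + 1) → Fin (n + 1))
          (Fin.cons 0 (Fin.succ ∘ g) : Fin (m + 1) → Fin (n + 1))) i.succ j.succ -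
        (W.submatrix (Fin.cons 0 (Fin.succ ∘ f) : Fin (m + 1) → Fin (n + 1))
          (Fin.cons 0 (Fin.succ ∘ g) : Fin (m + 1) → Fin (n + 1))) i.succ 0 *
        (W.submatrix (Fin.cons 0 (Fin.succ ∘ f) : Fin (m + 1) → Fin (n + 1))
          (Fin.cons 0 (Fin.succ ∘ g) : Fin (m + 1) → Fin (n + 1))) 0 0 *
        (W.submatrix (Fin.cons 0 (Fin.succ ∘ f) : Fin (m + 1) → Fin (n + 1))
          (Fin.cons 0 (Fin.succ ∘ g) : Fin (m + 1) → Fin (n + 1))) 0 j.succ := by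
        ext i j; simp [hS]
      rw [h5, h3, ← h6] at h4
      simp only [submatrix_apply, Fin.cons_zero] at h4
      obtain hp | hp := hpm <;> simpa [hp] using h4
    -- Entries of `S` lie between -2 and 2, and 2 and -2 are excluded: they are divisible by 2 but
    -- not by 3.
    have hSent : ∀ i j, S i j ∈ Set.range SignType.cast := by
      intro i l
      have h3 := hSsub 1 (fun _ => i) (fun _ => l)
      simp only [det_unique, submatrix_apply] at h3
      have hb (i j) : -1 ≤ W i j ∧ W i j ≤ 1 := by
        have h2 : W i j ∈ Set.range SignType.cast := h1 _ _
        simp only [mem_range_signType_cast_iff] at h2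
        omega
      have hval : S i l = W i.succ l.succ - W i.succ 0 * W 0 0 * W 0 l.succ := rfl
      have habs : |W i.succ 0 * W 0 0 * W 0 l.succ| ≤ 1 := by
        rw [abs_mul, abs_mul]
        have e1 := abs_le.2 (hb i.succ 0)
        have e2 := abs_le.2 (hb 0 0)
        have e3 := abs_le.2 (hb 0 l.succ)
        exact mul_le_one₀ (mul_le_one₀ e1 (abs_nonneg _) e2) (abs_nonneg _) e3
      have h5 := abs_le.1 habs
      have h6 := hb i.succ l.succ
      simp only [mem_range_signType_cast_iff]
      omega
    have hd := ih S hSent hSsub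
    obtain hp | hp := hpm <;> simpa [hp, hneg] using hd

/-- An integer matrix with entries `0`, `1`, `-1` all of whose minors vanish modulo `2` exactly
when they vanish modulo `3` is totally unimodular. -/
lemma isTotallyUnimodular_of_two_dvd_iff_three_dvd {m n : Type*} (Z : Matrix m n ℤ)
    (h1 : ∀ i j, Z i j ∈ Set.range SignType.cast)
    (h : ∀ (k : ℕ) (f : Fin k → m) (g : Fin k → n), Injective f → Injective g →
      (2 ∣ (Z.submatrix f g).det ↔ 3 ∣ (Z.submatrix f g).det)) : Z.IsTotallyUnimodular := by
  intro k f g _ _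
  refine det_mem_range_of_two_dvd_iff_three_dvd _ (fun i j => h1 _ _) fun l f' g' => ?_
  rw [submatrix_submatrix]
  by_cases hf : Injective (f ∘ f')
  · by_cases hg : Injective (g ∘ g')
    · exact h _ _ _ hf hg
    · simp only [Injective, not_forall] at hg
      obtain ⟨i, j, hij, hne⟩ := hg
      rw [det_zero_of_column_eq hne fun x => by simp only [submatrix_apply]; rw [hij]]
      simp
  · simp only [Injective, not_forall] at hf
    obtain ⟨i, j, hij, hne⟩ := hf
    rw [det_zero_of_row_eq hne (by ext x; simp only [submatrix_apply]; rw [hij])]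
    simp

lemma IsTotallyUnimodular.map_intCast {m n R : Type*} [CommRing R] {Z : Matrix m n ℤ}
    (h : Z.IsTotallyUnimodular) : (Z.map (Int.cast : ℤ → R)).IsTotallyUnimodular := by
  intro k f g hf hg
  obtain ⟨s, hs⟩ := h k f g hf hg
  have : ((Z.map (Int.cast : ℤ → R)).submatrix f g).det = ((Z.submatrix f g).det : R) := by
    rw [Int.cast_det]; rfl
  rw [this, ← hs]
  exact ⟨s, by cases s <;> simp⟩

/-- Columns over a field are linearly independent exactly if some full-size minor is nonzero. -/
lemma linearIndependent_col_iff_exists_det_ne_zero {m n K : Type*} [Field K] [Finite m]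
    [Fintype n] [DecidableEq n] (A : Matrix m n K) :
    LinearIndependent K A.col ↔ ∃ f : n → m, (A.submatrix f id).det ≠ 0 := by
  have := Fintype.ofFinite m
  constructor
  · intro h
    have hr : A.rank = Fintype.card n := by
      rw [← rank_transpose]
      exact LinearIndependent.rank_matrix h
    rw [rank_eq_finrank_span_row] at hr
    obtain ⟨κ, a, ha, hsp, hli⟩ := exists_linearIndependent' K A.row
    have : Fintype κ := Fintype.ofInjective a ha
    have hcard : Fintype.card n = Fintype.card κ := by
      rw [← hr, ← hsp, finrank_span_eq_card hli]
    let e := Fintype.equivOfCardEq hcard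
    refine ⟨a ∘ e, ?_⟩
    rw [← isUnit_iff_ne_zero, ← isUnit_iff_isUnit_det, ← linearIndependent_rows_iff_isUnit]
    exact hli.comp e e.injective
  · rintro ⟨f, hf⟩
    rw [← isUnit_iff_ne_zero, ← isUnit_iff_isUnit_det, ← linearIndependent_cols_iff_isUnit] at hf
    exact hf.of_comp (LinearMap.funLeft K K f)

/-- Minors of a matrix containing an identity matrix, in terms of linear dependences. -/
lemma det_submatrix_ne_zero_iff {m n κ K : Type*} [Field K] [Fintype m] [DecidableEq m]
    [Fintype n] [Fintype κ] [DecidableEq κ] {D : Matrix m n K} {ι : m → n}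
    (hD : D.submatrix id ι = 1) {f : κ → m} {g : κ → n} (hg : Injective g) :
    (D.submatrix f g).det ≠ 0 ↔ (∀ j b, g j = ι b → b ∈ Set.range f) ∧
      ∀ u : n → K, (∀ e, e ∉ Set.range g ∪ ι '' (Set.range f)ᶜ → u e = 0) → D *ᵥ u = 0 → u = 0 := by
  classical
  have hDι (i b) : D i (ι b) = if i = b then 1 else 0 := by
    rw [← one_apply, ← hD]; rfl
  have hι : Injective ι := fun a b hab => by
    by_contra h
    have h1 := hDι a a
    rw [hab, hDι a b] at h1
    simp [h] at h1
  constructor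
  · intro hdet
    have hrange : ∀ j b, g j = ι b → b ∈ Set.range f := by
      intro j b hjb
      by_contra hb
      refine hdet (det_eq_zero_of_column_eq_zero j fun i => ?_)
      rw [submatrix_apply, hjb, hDι, if_neg fun h => hb ⟨i, h⟩]
    refine ⟨hrange, fun u hu hDu => ?_⟩
    -- The identity columns `ι b` with `b` outside the range of `f` vanish on the rows `f`, so `u ∘
    -- g` is in the kernel of the minor.
    have hx : u ∘ g = 0 := by
      by_contra h0
      refine hdet (exists_mulVec_eq_zero_iff.1 ⟨u ∘ g, h0, ?_⟩)
      ext i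
      have h1 := congrFun hDu (f i)
      simp only [mulVec, dotProduct, Pi.zero_apply, submatrix_apply] at h1 ⊢
      change ∑ j, D (f i) (g j) * u (g j) = 0
      rw [← h1, ← Finset.sum_image (s := Finset.univ) (g := g) (f := fun e => D (f i) e * u e)
        hg.injOn]
      refine Finset.sum_subset (Finset.subset_univ _) fun e _ he => ?_
      by_cases hu0 : u e = 0
      · simp [hu0]
      have he' : e ∈ Set.range g ∪ ι '' (Set.range f)ᶜ := by_contra fun h => hu0 (hu e h)
      obtain ⟨j, rfl⟩ | ⟨b, hb, rfl⟩ := he'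
      · simp at he
      · rw [hDι, if_neg fun h => hb ⟨i, h⟩, zero_mul]
    have hsupp (e) (he : e ∉ Set.range ι) : u e = 0 := by
      by_cases heg : e ∈ Set.range g
      · obtain ⟨j, rfl⟩ := heg
        exact congrFun hx j
      · refine hu e fun h => h.elim heg ?_
        rintro ⟨b, _, rfl⟩
        exact he ⟨b, rfl⟩
    ext e
    by_cases he : e ∈ Set.range ι
    · obtain ⟨b, rfl⟩ := he
      have h1 := congrFun hDu b
      simp only [mulVec, dotProduct, Pi.zero_apply] at h1
      rw [Finset.sum_eq_single (ι b), hDι, if_pos rfl, one_mul] at h1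
      · exact h1
      · intro e _ heb
        by_cases he : e ∈ Set.range ι
        · obtain ⟨b', rfl⟩ := he
          rw [hDι, if_neg fun h : b = b' => heb (by rw [h]), zero_mul]
        · rw [hsupp e he, mul_zero]
      · simp
    · exact hsupp e he
  · rintro ⟨hrange, hu⟩ hdet
    obtain ⟨x, hx0, hx⟩ := exists_mulVec_eq_zero_iff.2 hdet
    -- A kernel vector of the minor, extended by zero, is annihilated by the rows `f`. Subtracting
    -- `t`, supported on the remaining identity columns, cancels the other rows.
    set y : n → K := extend g x 0 with hy
    set z : m → K := D *ᵥ y with hz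
    set t : n → K := extend ι z 0 with ht
    have hzf (i) : z (f i) = 0 := by
      have h1 := congrFun hx i
      simp only [mulVec, dotProduct, Pi.zero_apply, submatrix_apply] at h1
      rw [hz, mulVec, dotProduct, ← h1]
      have h2 (j) : x j = y (g j) := (hg.extend_apply x 0 j).symm
      simp_rw [h2]
      rw [← Finset.sum_image (s := Finset.univ) (g := g) (f := fun e => D (f i) e * y e) hg.injOn]
      refine (Finset.sum_subset (Finset.subset_univ _) fun e _ he => ?_).symm
      rw [hy, extend_apply', Pi.zero_apply, mul_zero]
      simpa using he
    have hDt : D *ᵥ t = z := by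
      ext i
      rw [mulVec, dotProduct, Finset.sum_eq_single (ι i), hDι, if_pos rfl, one_mul]
      · exact hι.extend_apply z 0 i
      · intro e _ hei
        by_cases he : e ∈ Set.range ι
        · obtain ⟨b', rfl⟩ := he
          rw [hDι, if_neg fun h : i = b' => hei (by rw [h]), zero_mul]
        · rw [ht, extend_apply' z (0 : n → K) e he, Pi.zero_apply, mul_zero]
      · simp
    have h0 := hu (y - t) (fun e he => by
      have h1 : y e = 0 := extend_apply' x (0 : n → K) e fun h => he (Or.inl h)
      have h2 : t e = 0 := by
        by_cases h : e ∈ Set.range ι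
        · obtain ⟨b, rfl⟩ := h
          have hb : b ∈ Set.range f := by_contra fun hb => he (Or.inr ⟨b, hb, rfl⟩)
          obtain ⟨i, rfl⟩ := hb
          rw [ht, hι.extend_apply, hzf]
        · exact extend_apply' z (0 : n → K) e h
      rw [Pi.sub_apply, h1, h2, sub_zero]) (by rw [mulVec_sub, hDt, sub_self])
    refine hx0 (funext fun j => ?_)
    have h1 := congrFun h0 (g j)
    have h2 : y (g j) = x j := hg.extend_apply x 0 j
    have h3 : t (g j) = 0 := by
      by_cases h : g j ∈ Set.range ι
      · obtain ⟨b, hb⟩ := h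
        obtain ⟨i, rfl⟩ := hrange j b hb.symm
        rw [← hb, ht, hι.extend_apply, hzf]
      · exact extend_apply' z (0 : n → K) _ h
    rwa [Pi.sub_apply, h2, h3, sub_zero] at h1

end Matrix

namespace Matrix

lemma linearIndependent_col_submatrix_iff {m n K : Type*} [Field K] [Fintype n]
    (D : Matrix m n K) (I : Set n) :
    LinearIndependent K (D.submatrix id (Subtype.val : I → n)).col ↔
      ∀ u : n → K, (∀ e, e ∉ I → u e = 0) → D *ᵥ u = 0 → u = 0 := by
  classical
  have key (u : n → K) (hu : ∀ e, e ∉ I → u e = 0) :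
      D.submatrix id (Subtype.val : I → n) *ᵥ (fun e : I => u e) = D *ᵥ u := by
    ext i
    refine Fintype.sum_of_injective Subtype.val Subtype.val_injective _ _ (fun x hx => ?_)
      fun x => rfl
    rw [hu x (by simpa using hx), mul_zero]
  rw [← mulVec_injective_iff]
  change Injective (mulVecLin _) ↔ _
  rw [injective_iff_map_eq_zero]
  constructor
  · intro h u hu hD
    have h0 := h (fun e : I => u e) (by rw [mulVecLin_apply, key u hu, hD])
    ext e
    by_cases he : e ∈ I
    · exact congrFun h0 ⟨e, he⟩
    · exact hu e he
  · intro h x hx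
    have hr : (fun e : I => extend Subtype.val x (0 : n → K) e) = x := by
      ext e; exact Subtype.val_injective.extend_apply x 0 e
    have hs : ∀ e, e ∉ I → extend Subtype.val x (0 : n → K) e = 0 := fun e he =>
      extend_apply' x (0 : n → K) e fun ⟨y, hy⟩ => he (hy ▸ y.2)
    have h0 := h _ hs (by rw [← key _ hs, hr]; exact hx)
    rw [← hr, h0]; rfl

end Matrix

/-! ### Finite matroids: standard representations, regularity and signings -/

namespace Matroid

open Matrix

variable {α : Type u} {M N : Matroid α} {k : Type*} [Field k]

/-- The inclusion of a base into the ground set. -/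
def IsBase.incl {B : Set α} (hB : N.IsBase B) (b : B) : N.E := ⟨b, hB.subset_ground b.2⟩

lemma finsum_eq_sum_ground [Fintype N.E] {g : α → k} (hg : support g ⊆ N.E) :
    ∑ᶠ e, g e = ∑ e : N.E, g e := by
  rw [← finsum_eq_sum_of_fintype, finsum_set_coe_eq_finsum_mem (f := g) N.E, finsum_mem_def,
    Set.indicator_eq_self.2 hg]

/-- The standard representation of a finite matroid with respect to a base. -/
lemma IsPaintable.exists_standardRep [Fintype N.E] {B : Set α} [DecidableEq B] [Fintype B]
    (hB : N.IsBase B) (h : N.IsPaintable k) :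
    ∃ D : Matrix B N.E k, D.submatrix id hB.incl = 1 ∧
      (∀ b e, D b e ≠ 0 ↔ (e : α) ∈ N.fundCocircuit b B) ∧
      ∀ I : Set N.E, N.Indep (Subtype.val '' I) ↔
        ∀ u : N.E → k, (∀ e, e ∉ I → u e = 0) → D *ᵥ u = 0 → u = 0 := by
  classical
  obtain ⟨c, d, hc, hd, h⟩ := h
  have hcd (o b) (ho : N.IsCircuit o) (hb : N.IsCocircuit b) :
      ∑ e : N.E, d b e * c o e = 0 := by
    rw [← (h o b ho hb).2, finsum_eq_sum_ground (N := N)]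
    · simp_rw [mul_comm]
    · exact (support_mul_subset_left _ _).trans ((hc o ho).subset.trans ho.subset_ground)
  have hK (b : B) : N.IsCocircuit (N.fundCocircuit b B) := fundCocircuit_isCocircuit b.2 hB
  have hdK (b : B) (e : α) : d (N.fundCocircuit b B) e ≠ 0 ↔ e ∈ N.fundCocircuit b B := by
    rw [← mem_support, hd _ (hK b)]
  have hdb (b : B) : d (N.fundCocircuit b B) b ≠ 0 := (hdK b b).2 (N.mem_fundCocircuit _ _)
  -- The rows are vectors of fundamental cocircuits, scaled to 1 at the base element.
  set D : Matrix B N.E k := of fun b e =>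
    (d (N.fundCocircuit b B) b)⁻¹ * d (N.fundCocircuit b B) e with hD
  have hDB (b b' : B) : D b (hB.incl b') = if b = b' then 1 else 0 := by
    simp only [hD, of_apply, IsBase.incl]
    split_ifs with hbb
    · subst hbb
      exact inv_mul_cancel₀ (hdb b)
    · suffices d (N.fundCocircuit b B) b' = 0 by simp [this]
      by_contra h0
      have := (N.fundCocircuit_inter_eq b.2).subset ⟨(hdK b b').1 h0, b'.2⟩
      exact hbb (Subtype.ext this.symm)
  have hDo (o) (ho : N.IsCircuit o) : D *ᵥ (fun e => c o e) = 0 := by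
    ext b
    simp only [mulVec, dotProduct, hD, of_apply, mul_assoc, Pi.zero_apply]
    rw [← Finset.mul_sum, hcd o _ ho (hK b), mul_zero]
  refine ⟨D, by ext b b'; rw [submatrix_apply, id, hDB, one_apply], fun b e => ?_, fun I => ?_⟩
  · simp only [hD, of_apply, ← hdK, ne_eq, mul_eq_zero, inv_eq_zero, hdb, false_or]
  constructor
  · intro hi u hu hDu
    ext e
    by_contra he
    have heI : e ∈ I := by_contra fun h => he (hu e h)
    obtain ⟨b, hb, hbI⟩ := Indep.exists_isCocircuit_inter_eq_mem hi (e := (e : α)) ⟨e, heI, rfl⟩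
    -- the row of `b` is a combination of the rows of `D`
    have hrow (x : N.E) : d b x = ∑ y : B, d b y * D y x := by
      rw [← sub_eq_zero]
      set g : N.E → k := fun x => d b x - ∑ y : B, d b y * D y x with hg
      have hgB (y : B) : g (hB.incl y) = 0 := by
        simp only [hg, hDB]
        simp [IsBase.incl]
      have hgo (o) (ho : N.IsCircuit o) : ∑ x, g x * c o x = 0 := by
        simp only [hg, sub_mul, Finset.sum_sub_distrib, hcd o b ho hb, Finset.sum_mul, zero_sub]
        rw [Finset.sum_comm, neg_eq_zero]
        refine Finset.sum_eq_zero fun y _ => ?_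
        have := congrFun (hDo o ho) y
        simp only [mulVec, dotProduct, Pi.zero_apply] at this
        simp_rw [mul_assoc]
        rw [← Finset.mul_sum, this, mul_zero]
      by_cases hx : (x : α) ∈ B
      · exact hgB ⟨x, hx⟩
      -- `g` vanishes on `B` and is orthogonal to every circuit; the fundamental circuit of `x` then
      -- leaves only the term at `x`.
      have ho := hB.fundCircuit_isCircuit x.2 hx
      have h1 := hgo _ ho
      have h2 := N.fundCircuit_subset_insert x B
      rw [Finset.sum_eq_single x] at h1
      · have : c (N.fundCircuit x B) x ≠ 0 := by
          rw [← mem_support, hc _ ho]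
          exact N.mem_fundCircuit _ _
        exact (mul_eq_zero.1 h1).resolve_right this
      · intro y _ hyx
        by_contra h0
        have hyo : (y : α) ∈ N.fundCircuit x B := hc _ ho ▸ right_ne_zero_of_mul h0
        have hyB := (h2 hyo).resolve_left fun h => hyx (Subtype.ext h)
        exact left_ne_zero_of_mul h0 (hgB ⟨y, hyB⟩)
      · simp
    have h1 : ∑ x : N.E, d b x * u x = 0 := by
      simp_rw [hrow, Finset.sum_mul]
      rw [Finset.sum_comm]
      refine Finset.sum_eq_zero fun y _ => ?_
      have := congrFun hDu y
      simp only [mulVec, dotProduct, Pi.zero_apply] at this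
      simp_rw [mul_assoc]
      rw [← Finset.mul_sum, this, mul_zero]
    rw [Finset.sum_eq_single e] at h1
    · have : d b e ≠ 0 := by
        rw [← mem_support, hd b hb]
        exact (hbI.symm.subset rfl).1
      exact mul_ne_zero this he h1
    · intro y _ hye
      by_contra h0
      have hyb : (y : α) ∈ b := hd b hb ▸ left_ne_zero_of_mul h0
      have hyI : y ∈ I := by_contra fun h => right_ne_zero_of_mul h0 (hu y h)
      exact hye (Subtype.ext (hbI.subset ⟨hyb, y, hyI, rfl⟩))
    · simp
  · intro hu
    rw [indep_iff_forall_subset_not_isCircuit (by simp)]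
    intro o hoI ho
    obtain ⟨e, he⟩ := ho.nonempty
    obtain ⟨x, hx, rfl⟩ := hoI he
    have h0 := congrFun (hu (fun e => c o e) (fun e heI => ?_) (hDo o ho)) x
    · have : (x : α) ∈ support (c o) := (hc o ho).symm ▸ he
      exact this h0
    · by_contra h0
      obtain ⟨y, hy, hye⟩ := hoI ((hc o ho).subset h0)
      exact heI (Subtype.ext hye ▸ hy)

/-- A finite matroid that is representable over the fields with two and three elements is
regular. -/
lemma IsPaintable.isRegular (hN : N.Finite) (h2 : N.IsPaintable (ZMod 2))
    (h3 : N.IsPaintable (ZMod 3)) : N.IsRegular := by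
  classical
  have : Fintype N.E := hN.ground_finite.fintype
  obtain ⟨B, hB⟩ := N.exists_isBase
  have : Fintype B := (hN.ground_finite.subset hB.subset_ground).fintype
  obtain ⟨D₂, h2B, h2s, h2I⟩ := h2.exists_standardRep hB
  obtain ⟨D₃, h3B, h3s, h3I⟩ := h3.exists_standardRep hB
  set Z : Matrix B N.E ℤ := D₃.map ZMod.valMinAbs with hZ
  have hZ3 : Z.map (Int.cast : ℤ → ZMod 3) = D₃ := by ext b e; simp [hZ]
  have hZ2 : Z.map (Int.cast : ℤ → ZMod 2) = D₂ := by
    -- Both zero patterns are given by the fundamental cocircuits, and over two elements the zero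
    -- pattern is the whole matrix.
    have key : ∀ (x : ZMod 3) (y : ZMod 2), (x ≠ 0 ↔ y ≠ 0) → ((x.valMinAbs : ℤ) : ZMod 2) = y := by
      decide
    ext b e
    exact key _ _ ((h3s b e).trans (h2s b e).symm)
  have hdet {p : ℕ} {D : Matrix B N.E (ZMod p)} (hD : Z.map (Int.cast : ℤ → ZMod p) = D)
      {κ : Type u} [Fintype κ] [DecidableEq κ] (f : κ → B) (g : κ → N.E) :
      (((Z.submatrix f g).det : ℤ) : ZMod p) = (D.submatrix f g).det := by
    rw [Int.cast_det, ← hD]; rfl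
  have hdet' {p : ℕ} {D : Matrix B N.E (ZMod p)} (hD : Z.map (Int.cast : ℤ → ZMod p) = D)
      {κ : ℕ} (f : Fin κ → B) (g : Fin κ → N.E) :
      (((Z.submatrix f g).det : ℤ) : ZMod p) = (D.submatrix f g).det := by
    rw [Int.cast_det, ← hD]; rfl
  have hTU : Z.IsTotallyUnimodular := by
    refine isTotallyUnimodular_of_two_dvd_iff_three_dvd Z (fun b e => ?_) fun κ f g _ hg => ?_
    · rw [mem_range_signType_cast_iff]
      have key : ∀ x : ZMod 3, x.valMinAbs = 0 ∨ x.valMinAbs = -1 ∨ x.valMinAbs = 1 := by decide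
      exact key _
    · have e2 := (ZMod.intCast_zmod_eq_zero_iff_dvd (Z.submatrix f g).det 2)
      have e3 := (ZMod.intCast_zmod_eq_zero_iff_dvd (Z.submatrix f g).det 3)
      rw [hdet' hZ2] at e2
      rw [hdet' hZ3] at e3
      refine e2.symm.trans (Iff.trans ?_ e3)
      -- The criterion for a nonzero minor mentions only independent sets of `N`, so it is the same
      -- over both fields.
      rw [← not_iff_not, ← ne_eq, ← ne_eq, det_submatrix_ne_zero_iff h2B hg,
        det_submatrix_ne_zero_iff h3B hg, ← h2I, ← h3I]
  let eB := Fintype.equivFin B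
  refine ⟨Fintype.card B, (Z.map Int.cast).submatrix eB.symm id,
    hTU.map_intCast.submatrix _ _, fun I => ?_⟩
  rw [h3I, ← linearIndependent_col_submatrix_iff]
  change _ ↔ LinearIndependent ℝ
    ((((Z.map Int.cast).submatrix eB.symm id)).submatrix id (Subtype.val : I → N.E)).col
  rw [linearIndependent_col_iff_exists_det_ne_zero, linearIndependent_col_iff_exists_det_ne_zero]
  have hiff (f : I → B) : (D₃.submatrix f (Subtype.val : I → N.E)).det ≠ 0 ↔
      ((Z.map (Int.cast : ℤ → ℝ)).submatrix f (Subtype.val : I → N.E)).det ≠ 0 := by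
    have e1 : ((Z.map (Int.cast : ℤ → ℝ)).submatrix f (Subtype.val : I → N.E)).det =
      ((Z.submatrix f (Subtype.val : I → N.E)).det : ℝ) := by rw [Int.cast_det]; rfl
    rw [e1, ← hdet hZ3]
    have := (isTotallyUnimodular_iff_fintype Z).1 hTU I f Subtype.val
    rw [mem_range_signType_cast_iff] at this
    obtain h | h | h := this <;> simp [h]
  constructor
  · rintro ⟨f, hf⟩
    refine ⟨eB ∘ f, ?_⟩
    have := (hiff f).1 hf
    rw [submatrix_submatrix, submatrix_submatrix]
    convert! this using 3
    ext x; simp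
  · rintro ⟨f, hf⟩
    exact ⟨eB.symm ∘ f, (hiff _).2 hf⟩

/-- The standard form of a totally unimodular representation has entries `0`, `1`, `-1`. -/
lemma exists_standardForm_of_isTotallyUnimodular [Fintype N.E] {r : ℕ}
    {A : Matrix (Fin r) N.E ℝ} (hA : A.IsTotallyUnimodular) {B : Set α} [Fintype B]
    [DecidableEq B] (hB : N.IsBase B) (hli : LinearIndependent ℝ (A.submatrix id hB.incl).col) :
    ∃ Q : Matrix B N.E ℝ, Q.submatrix id hB.incl = 1 ∧
      (∀ b e, Q b e ∈ Set.range SignType.cast) ∧ ∀ u, A *ᵥ u = 0 → Q *ᵥ u = 0 := by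
  obtain ⟨f, hf⟩ := (linearIndependent_col_iff_exists_det_ne_zero _).1 hli
  rw [submatrix_submatrix] at hf
  set P := A.submatrix (id ∘ f) (hB.incl ∘ id) with hP
  have hPu : IsUnit P.det := isUnit_iff_ne_zero.2 hf
  have hTU (g : B → N.E) : (A.submatrix f g).det ∈ Set.range SignType.cast :=
    (isTotallyUnimodular_iff_fintype A).1 hA B f g
  refine ⟨P⁻¹ * A.submatrix f id, ?_, fun b e => ?_, fun u hu => ?_⟩
  · have : (P⁻¹ * A.submatrix f id).submatrix id hB.incl = P⁻¹ * P := by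
      ext b b'; simp [mul_apply, hP]
    rw [this, nonsing_inv_mul _ hPu]
  · have h1 : (P⁻¹ * A.submatrix f id) b e = (P.det)⁻¹ *
        (A.submatrix f (update hB.incl b e)).det := by
      have h2 : A.submatrix f (update hB.incl b e) = P.updateCol b fun i => A (f i) e := by
        ext i j
        by_cases hj : j = b
        · subst hj; simp
        · simp [hj, hP]
      rw [h2, ← cramer_apply, cramer_eq_adjugate_mulVec, inv_def, Ring.inverse_eq_inv']
      simp [mul_apply, mulVec, dotProduct, Finset.mul_sum, mul_assoc]
    have h3 := hTU (update hB.incl b e)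
    have h4 : P.det ∈ Set.range SignType.cast := hTU hB.incl
    rw [mem_range_signType_cast_iff] at h3 h4 ⊢
    rw [h1]
    obtain h4 | h4 | h4 := h4
    · exact absurd h4 hf
    all_goals rw [h4]; obtain h3 | h3 | h3 := h3 <;> simp [h3]
  · rw [← mulVec_mulVec]
    have : A.submatrix f id *ᵥ u = 0 := by
      ext i
      exact congrFun hu (f i)
    rw [this, mulVec_zero]

/-- Extend `b \ {f}` to a base of the dual: `b` is the fundamental circuit of `f` there, and the
complementary base serves. -/
lemma IsCocircuit.exists_isBase_eq_fundCocircuit {b : Set α} (hb : N.IsCocircuit b) :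
    ∃ B f, N.IsBase B ∧ f ∈ B ∧ b = N.fundCocircuit f B := by
  obtain ⟨f, hf⟩ := hb.nonempty
  obtain ⟨B', hB', hbB'⟩ := (hb.isCircuit.sdiff_singleton_indep hf).exists_isBase_superset
  have hfB' : f ∉ B' := fun h => hb.isCircuit.not_indep
    (hB'.indep.subset fun x hx => by
      by_cases hxf : x = f
      · exact hxf ▸ h
      · exact hbB' ⟨hx, hxf⟩)
  have hBB : N✶.E \ (N.E \ B') = B' := by
    exact Set.sdiff_sdiff_cancel_left hB'.subset_ground
  refine ⟨N.E \ B', f, hB'.compl_isBase_of_dual, ⟨hb.subset_ground hf, hfB'⟩, ?_⟩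
  rw [fundCocircuit, hBB]
  refine hb.isCircuit.eq_fundCircuit_of_subset hB'.indep fun x hx => ?_
  by_cases hxf : x = f
  · exact Or.inl hxf
  · exact Or.inr (hbB' ⟨hx, hxf⟩)

/-- A finite regular matroid is signable. -/
lemma IsRegular.isSignable (hN : N.Finite) (h : N.IsRegular) : N.IsSignable := by
  classical
  have : Fintype N.E := hN.ground_finite.fintype
  obtain ⟨r, A, hTU, hA⟩ := h
  have hA' (I : Set N.E) : N.Indep (Subtype.val '' I) ↔
      ∀ u : N.E → ℝ, (∀ e, e ∉ I → u e = 0) → A *ᵥ u = 0 → u = 0 := by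
    rw [hA, ← linearIndependent_col_submatrix_iff]; rfl
  have hQ (B : Set α) (hB : N.IsBase B) : ∃ Q : Matrix B N.E ℝ,
      (∀ b b' : B, Q b (hB.incl b') = if b = b' then 1 else 0) ∧
      (∀ b e, Q b e = 0 ∨ Q b e = -1 ∨ Q b e = 1) ∧
      ∀ u, A *ᵥ u = 0 → ∀ b, ∑ e, Q b e * u e = 0 := by
    have : Fintype B := (hN.ground_finite.subset hB.subset_ground).fintype
    have hli : LinearIndependent ℝ (A.submatrix id hB.incl).col := by
      have h1 := (hA (Subtype.val ⁻¹' B)).1 (hB.indep.subset (by simp))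
      exact h1.comp (fun b : B => (⟨hB.incl b, b.2⟩ : Subtype.val ⁻¹' B)) fun x y hxy =>
        Subtype.ext (congrArg (fun z => (z.1 : α)) hxy)
    obtain ⟨Q, h1, h2, h3⟩ := exists_standardForm_of_isTotallyUnimodular hTU hB hli
    refine ⟨Q, fun b b' => ?_, fun b e => mem_range_signType_cast_iff.1 (h2 b e),
      fun u hu b => congrFun (h3 u hu) b⟩
    rw [← one_apply, ← h1]; rfl
  -- a kernel vector supported in `insert e B`
  have hsum (B : Set α) (hB : N.IsBase B) (Q : Matrix B N.E ℝ)
      (hQ1 : ∀ b b' : B, Q b (hB.incl b') = if b = b' then 1 else 0) (e : N.E) (he : (e : α) ∉ B)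
      (u : N.E → ℝ) (hu : ∀ x, u x ≠ 0 → (x : α) ∈ insert (e : α) B) (b : B) :
      ∑ x, Q b x * u x = Q b e * u e + u (hB.incl b) := by
    have hne : e ≠ hB.incl b := fun h => he (by rw [h]; exact b.2)
    rw [Finset.sum_eq_add_of_mem e (hB.incl b) (Finset.mem_univ _) (Finset.mem_univ _) hne,
      hQ1, if_pos rfl, one_mul]
    rintro x _ ⟨hxe, hxb⟩
    by_contra h0
    have hxB : (x : α) ∈ B := (hu x (right_ne_zero_of_mul h0)).resolve_left
      fun h => hxe (Subtype.ext h)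
    have : Q b x = if b = ⟨x, hxB⟩ then 1 else 0 := hQ1 b ⟨x, hxB⟩
    refine left_ne_zero_of_mul h0 (this.trans (if_neg ?_))
    rintro rfl
    exact hxb rfl
  have hvec (o : Set α) (ho : N.IsCircuit o) : ∃ u : N.E → ℝ, A *ᵥ u = 0 ∧
      ∀ x, u x ≠ 0 ↔ (x : α) ∈ o := by
    have h1 := ho.not_indep
    rw [← Set.inter_eq_self_of_subset_right ho.subset_ground, ← Subtype.image_preimage_val,
      hA'] at h1
    push Not at h1
    obtain ⟨u, hu, hAu, hu0⟩ := h1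
    have huo : Subtype.val '' support u ⊆ o := by
      rintro _ ⟨x, hx, rfl⟩
      exact by_contra fun h => hx (hu x h)
    have hsupp : Subtype.val '' support u = o := by
      refine ho.eq_of_not_indep_subset (fun hi => hu0 ?_) huo
      exact (hA' _).1 hi u (fun e he => by simpa using he) hAu
    refine ⟨u, hAu, fun x => ?_⟩
    rw [← hsupp]
    simp
  have hunit (x : ℝ) (hx : x = -1 ∨ x = 1) : ∃ s : ℤˣ, ((s : ℤ) : ℝ) = x := by
    obtain rfl | rfl := hx
    exacts [⟨-1, by simp⟩, ⟨1, by simp⟩]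
  have hc (o : Set α) (ho : N.IsCircuit o) : ∃ s : α → ℤˣ,
      A *ᵥ (fun x : N.E => if (x : α) ∈ o then ((s x : ℤ) : ℝ) else 0) = 0 := by
    obtain ⟨u, hAu, hu⟩ := hvec o ho
    obtain ⟨e, he⟩ := ho.nonempty
    have heE := ho.subset_ground he
    have hue : u ⟨e, heE⟩ ≠ 0 := (hu ⟨e, heE⟩).2 he
    obtain ⟨B, hB, hoB⟩ := (ho.sdiff_singleton_indep he).exists_isBase_superset
    have hsub : o ⊆ insert e B := by rwa [← Set.sdiff_singleton_subset_iff]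
    have heB : e ∉ B := fun h => ho.not_indep (hB.indep.subset (by rwa [Set.insert_eq_of_mem h] at hsub))
    obtain ⟨Q, hQ1, hQ2, hQ3⟩ := hQ B hB
    have hval (x : N.E) (hx : (x : α) ∈ o) : ∃ s : ℤˣ, ((s : ℤ) : ℝ) = (u ⟨e, heE⟩)⁻¹ * u x := by
      refine hunit _ ?_
      by_cases hxe : (x : α) = e
      · obtain rfl : x = ⟨e, heE⟩ := Subtype.ext hxe
        exact Or.inr (inv_mul_cancel₀ hue)
      · have hxB := (hsub hx).resolve_left hxe
        -- Row `x` of the standard form reads `Q x e * u e + u x = 0` with `Q x e` among 0, 1, -1,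
        -- so `u x` is `u e` up to sign.
        have h1 := hsum B hB Q hQ1 ⟨e, heE⟩ heB u (fun y hy => hsub ((hu y).1 hy)) ⟨x, hxB⟩
        rw [hQ3 u hAu] at h1
        have h2 : u (hB.incl ⟨x, hxB⟩) ≠ 0 := (hu _).2 hx
        have h3 : u (hB.incl ⟨x, hxB⟩) = u x := rfl
        rw [h3] at h1 h2
        obtain h | h | h := hQ2 ⟨x, hxB⟩ ⟨e, heE⟩
        · rw [h, zero_mul, zero_add] at h1
          exact absurd h1.symm h2
        · right
          rw [h] at h1
          rw [show u x = u ⟨e, heE⟩ by linarith, inv_mul_cancel₀ hue]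
        · left
          rw [h] at h1
          rw [show u x = -u ⟨e, heE⟩ by linarith, mul_neg, inv_mul_cancel₀ hue]
    choose! s hs using hval
    refine ⟨fun x => if hx : x ∈ N.E then s ⟨x, hx⟩ else 1, ?_⟩
    have : (fun x : N.E => if (x : α) ∈ o then
        (((if hx : (x : α) ∈ N.E then s ⟨x, hx⟩ else 1 : ℤˣ) : ℤ) : ℝ) else 0) =
        (u ⟨e, heE⟩)⁻¹ • u := by
      ext x
      by_cases hx : (x : α) ∈ o
      · simp [hx, hs x hx]
      · have : u x = 0 := by_contra fun h => hx ((hu x).1 h)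
        simp [hx, this]
    rw [this, mulVec_smul, hAu, smul_zero]
  have hd (b : Set α) (hb : N.IsCocircuit b) : ∃ t : α → ℤˣ, ∀ u : N.E → ℝ, A *ᵥ u = 0 →
      ∑ x : N.E, (if (x : α) ∈ b then ((t x : ℤ) : ℝ) else 0) * u x = 0 := by
    obtain ⟨B, f, hB, hf, rfl⟩ := hb.exists_isBase_eq_fundCocircuit
    obtain ⟨Q, hQ1, hQ2, hQ3⟩ := hQ B hB
    -- On `B` this is the identity block; off `B`, the kernel vector of the fundamental circuit of
    -- `x` ties the entry at `x` to its value at `f`.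
    have hQs (x : N.E) : Q ⟨f, hf⟩ x ≠ 0 ↔ (x : α) ∈ N.fundCocircuit f B := by
      by_cases hx : (x : α) ∈ B
      · have h1 : Q ⟨f, hf⟩ x = if (⟨f, hf⟩ : B) = ⟨x, hx⟩ then 1 else 0 := hQ1 _ ⟨x, hx⟩
        have h2 := N.fundCocircuit_inter_eq hf
        rw [h1]
        by_cases hxf : f = x
        · subst hxf
          simp [N.mem_fundCocircuit]
        · have : (x : α) ∉ N.fundCocircuit f B := fun h => hxf (h2.subset ⟨h, hx⟩).symm
          simp [hxf, this]
      · have ho := hB.fundCircuit_isCircuit x.2 hx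
        obtain ⟨u, hAu, hu⟩ := hvec _ ho
        have h1 := hsum B hB Q hQ1 x hx u
          (fun y hy => N.fundCircuit_subset_insert _ _ ((hu y).1 hy)) ⟨f, hf⟩
        rw [hQ3 u hAu] at h1
        have hux : u x ≠ 0 := (hu x).2 (N.mem_fundCircuit _ _)
        have huf : u (hB.incl ⟨f, hf⟩) ≠ 0 ↔ f ∈ N.fundCircuit x B := hu _
        rw [hB.mem_fundCocircuit_iff_mem_fundCircuit, ← huf, not_iff_not]
        constructor
        · intro h
          rw [h] at h1
          linarith
        · intro h
          rw [h, add_zero] at h1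
          exact (mul_eq_zero.1 h1.symm).resolve_right hux
    have hval (x : N.E) (hx : (x : α) ∈ N.fundCocircuit f B) :
        ∃ s : ℤˣ, ((s : ℤ) : ℝ) = Q ⟨f, hf⟩ x :=
      hunit _ ((hQ2 _ _).resolve_left ((hQs x).2 hx))
    choose! s hs using hval
    refine ⟨fun x => if hx : x ∈ N.E then s ⟨x, hx⟩ else 1, fun u hu => ?_⟩
    refine Eq.trans (Finset.sum_congr rfl fun x _ => ?_) (hQ3 u hu ⟨f, hf⟩)
    by_cases hx : (x : α) ∈ N.fundCocircuit f B
    · simp [hx, hs x hx]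
    · have : Q ⟨f, hf⟩ x = 0 := by_contra fun h => hx ((hQs x).1 h)
      rw [if_neg hx, this]
  choose! c hc using hc
  choose! d hd using hd
  refine ⟨c, d, fun o b ho hb => ?_⟩
  have hfin : (o ∩ b).Finite := hN.ground_finite.subset
    (Set.inter_subset_left.trans ho.subset_ground)
  refine ⟨hfin, ?_⟩
  have h1 := hd b hb _ (hc o ho)
  have h2 : ((∑ᶠ e ∈ o ∩ b, (c o e : ℤ) * (d b e : ℤ) : ℤ) : ℝ) = 0 := by
    rw [finsum_mem_eq_finite_toFinset_sum _ hfin, Int.cast_sum, ← h1]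
    rw [← finsum_eq_sum_ground (N := N)
      (g := fun x => (if x ∈ b then ((d b x : ℤ) : ℝ) else 0) *
        (if x ∈ o then ((c o x : ℤ) : ℝ) else 0))]
    · rw [finsum_eq_sum_of_support_subset (s := hfin.toFinset)]
      · refine Finset.sum_congr rfl fun e he => ?_
        rw [Set.Finite.mem_toFinset] at he
        simp [he.1, he.2, mul_comm]
      · intro e he
        rw [Set.Finite.coe_toFinset]
        simp only [mem_support, ne_eq, mul_eq_zero, not_or] at he
        exact ⟨by_contra fun h => he.2 (by simp [h]), by_contra fun h => he.1 (by simp [h])⟩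
    · intro e he
      refine ho.subset_ground (by_contra fun h => he (by simp [h]))
  exact_mod_cast h2

end Matroid

/-! ### Finite minors preserving intersections, and compactness -/

namespace Matroid

variable {α : Type u} {M N : Matroid α}

lemma IsCircuit.exists_isCircuit_contract {o C : Set α} {e : α} (ho : M.IsCircuit o)
    (he : e ∈ o) (heC : e ∉ C) : ∃ o' ⊆ o \ C, e ∈ o' ∧ (M ／ C).IsCircuit o' := by
  have hcl : e ∈ (M ／ C).closure ((o \ C) \ {e}) := by
    rw [contract_closure_eq]
    refine ⟨?_, heC⟩
    refine M.closure_subset_closure ?_ (ho.mem_closure_sdiff_singleton_of_mem he)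
    rintro x ⟨hxo, hxe⟩
    by_cases hx : x ∈ C
    · exact Or.inr hx
    · exact Or.inl ⟨⟨hxo, hx⟩, hxe⟩
  obtain ⟨o', ho', hoc, heo⟩ := exists_isCircuit_of_mem_closure hcl (by simp)
  exact ⟨o', ho'.trans (Set.insert_subset ⟨he, heC⟩ Set.sdiff_subset), heo, hoc⟩

/-- A circuit `o` whose elements outside `C` are not in `D` leaves in `M ／ C ＼ D` a circuit that
contains all elements of `o ∩ F` which can be separated by cocircuits avoiding `C`. -/
lemma IsCircuit.exists_isCircuit_minor {o C D F : Set α} {e : α} (ho : M.IsCircuit o)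
    (hoD : Disjoint (o \ C) D) (he : e ∈ o) (heC : e ∉ C)
    (hF : ∀ f ∈ o ∩ F, f ≠ e → ∃ b, M.IsCocircuit b ∧ o ∩ b = {e, f} ∧ Disjoint b C) :
    ∃ o', (M ／ C ＼ D).IsCircuit o' ∧ o' ⊆ o ∧ o ∩ F ⊆ o' := by
  obtain ⟨o', hoo, heo, hc⟩ := ho.exists_isCircuit_contract he heC
  have hN : (M ／ C ＼ D).IsCircuit o' := by
    rw [delete_isCircuit_iff]
    exact ⟨hc, hoD.mono_left hoo⟩
  refine ⟨o', hN, hoo.trans Set.sdiff_subset, fun f hf => ?_⟩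
  by_cases hfe : f = e
  · exact hfe ▸ heo
  -- Some cocircuit of the minor contains `e` and lies inside `b`. It meets `o'` within `{e, f}` but
  -- not in `e` alone, which forces `f ∈ o'`.
  obtain ⟨b, hb, hob, hbC⟩ := hF f hf hfe
  have hb1 : (M✶ ＼ C).IsCircuit b := by
    rw [delete_isCircuit_iff]
    exact ⟨hb, hbC⟩
  have heb : e ∈ b := (hob.symm.subset (Set.mem_insert _ _)).2
  obtain ⟨b', hbb, heb', hb'⟩ := hb1.exists_isCircuit_contract heb
    (Set.disjoint_left.1 hoD ⟨he, heC⟩)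
  rw [← dual_contract_delete] at hb'
  obtain ⟨x, ⟨hxo, hxb⟩, hxe⟩ :=
    (hN.isCocircuit_inter_nontrivial hb' ⟨e, heo, heb'⟩).exists_ne e
  have hx : x ∈ ({e, f} : Set α) := hob.subset ⟨(hoo hxo).1, (hbb hxb).1⟩
  obtain rfl : x = f := hx.resolve_left hxe
  exact hxo

/-- Finitely many circuits and cocircuits of a tame matroid have traces with unchanged pairwise
intersections in some finite minor. -/
lemma IsTame.exists_finite_minor (hM : M.IsTame) {O B : Set (Set α)} (hO : O.Finite)
    (hB : B.Finite) (hOc : ∀ o ∈ O, M.IsCircuit o) (hBc : ∀ b ∈ B, M.IsCocircuit b) :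
    ∃ (N : Matroid α) (φ ψ : Set α → Set α), N ≤m M ∧ N.Finite ∧
      ∀ o ∈ O, ∀ b ∈ B, (o ∩ b).Nonempty →
        N.IsCircuit (φ o) ∧ N.IsCocircuit (ψ b) ∧ φ o ∩ ψ b = o ∩ b := by
  classical
  have hfin {O B : Set (Set α)} (hO : O.Finite) (hB : B.Finite) (hOc : ∀ o ∈ O, M.IsCircuit o)
      (hBc : ∀ b ∈ B, M.IsCocircuit b) : (⋃₀ O ∩ ⋃₀ B).Finite := by
    rw [Set.sUnion_inter_sUnion]
    exact (hO.prod hB).biUnion fun p hp => hM _ _ (hOc _ hp.1) (hBc _ hp.2)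
  set F := ⋃₀ O ∩ ⋃₀ B with hF
  have hFfin : F.Finite := hfin hO hB hOc hBc
  have hK (o e f) : M.IsCircuit o ∧ e ∈ o ∧ f ∈ o ∧ f ≠ e →
      ∃ b, M.IsCocircuit b ∧ o ∩ b = {e, f} := fun h =>
    h.1.exists_isCocircuit_inter_eq_pair h.2.1 h.2.2.1 h.2.2.2
  have hL (b e f) : M.IsCocircuit b ∧ e ∈ b ∧ f ∈ b ∧ f ≠ e →
      ∃ o, M.IsCircuit o ∧ o ∩ b = {e, f} := fun h =>
    h.1.exists_isCircuit_inter_eq_pair h.2.1 h.2.2.1 h.2.2.2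
  choose! K hKc hKo using hK
  choose! L hLc hLb using hL
  -- The added cocircuits and circuits separate pairs in `F`: they certify that the traces lose no
  -- element of `F`.
  set B' := B ∪ {b | ∃ o ∈ O, ∃ e ∈ F, ∃ f ∈ F, (e ∈ o ∧ f ∈ o ∧ f ≠ e) ∧ K o e f = b} with hB'
  set O' := O ∪ {o | ∃ b ∈ B, ∃ e ∈ F, ∃ f ∈ F, (e ∈ b ∧ f ∈ b ∧ f ≠ e) ∧ L b e f = o} with hO'
  have hB'c : ∀ b ∈ B', M.IsCocircuit b := by
    rintro b (hb | ⟨o, ho, e, -, f, -, h, rfl⟩)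
    exacts [hBc b hb, hKc o e f ⟨hOc o ho, h⟩]
  have hO'c : ∀ o ∈ O', M.IsCircuit o := by
    rintro o (ho | ⟨b, hb, e, -, f, -, h, rfl⟩)
    exacts [hOc o ho, hLc b e f ⟨hBc b hb, h⟩]
  have hB'fin : B'.Finite := by
    refine hB.union (((hO.prod (hFfin.prod hFfin)).image fun p => K p.1 p.2.1 p.2.2).subset ?_)
    rintro b ⟨o, ho, e, he, f, hf, -, rfl⟩
    exact ⟨(o, e, f), ⟨ho, he, hf⟩, rfl⟩
  have hO'fin : O'.Finite := by
    refine hO.union (((hB.prod (hFfin.prod hFfin)).image fun p => L p.1 p.2.1 p.2.2).subset ?_)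
    rintro o ⟨b, hb, e, he, f, hf, -, rfl⟩
    exact ⟨(b, e, f), ⟨hb, he, hf⟩, rfl⟩
  set G := ⋃₀ O' ∩ ⋃₀ B' with hG
  have hGfin : G.Finite := hfin hO'fin hB'fin hO'c hB'c
  have hFG : F ⊆ G := Set.inter_subset_inter
    (Set.sUnion_subset_sUnion Set.subset_union_left) (Set.sUnion_subset_sUnion Set.subset_union_left)
  -- Only the finite set `G` is kept. What else the circuits use is contracted and everything else
  -- deleted, so cocircuits in `B'` avoid `C` and circuits in `O'` avoid `D`.
  set C := ⋃₀ O' \ G with hC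
  set D := (M.E \ G) \ C with hD
  have hCD : Disjoint C D := Set.disjoint_sdiff_right
  have hbC (b) (hb : b ∈ B') : Disjoint b C := by
    rw [Set.disjoint_left]
    rintro x hxb ⟨hxO, hxG⟩
    exact hxG ⟨hxO, b, hb, hxb⟩
  have hoD (o) (ho : o ∈ O') : Disjoint o D := by
    rw [Set.disjoint_left]
    rintro x hxo ⟨⟨-, hxG⟩, hxC⟩
    exact hxC ⟨⟨o, ho, hxo⟩, hxG⟩
  have hbD (b) (hb : b ∈ B') : Disjoint (b \ D) C := (hbC b hb).mono_left Set.sdiff_subset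
  have hφ (o) (ho : o ∈ O) (hoF : (o ∩ F).Nonempty) :
      ∃ o', (M ／ C ＼ D).IsCircuit o' ∧ o' ⊆ o ∧ o ∩ F ⊆ o' := by
    obtain ⟨e, heo, heF⟩ := hoF
    refine (hOc o ho).exists_isCircuit_minor
      ((hoD o (Or.inl ho)).mono_left Set.sdiff_subset) heo (fun h => h.2 (hFG heF)) ?_
    rintro f ⟨hfo, hfF⟩ hfe
    exact ⟨K o e f, hKc o e f ⟨hOc o ho, heo, hfo, hfe⟩, hKo o e f ⟨hOc o ho, heo, hfo, hfe⟩,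
      hbC _ (Or.inr ⟨o, ho, e, heF, f, hfF, ⟨heo, hfo, hfe⟩, rfl⟩)⟩
  have hψ (b) (hb : b ∈ B) (hbF : (b ∩ F).Nonempty) :
      ∃ b', (M ／ C ＼ D).IsCocircuit b' ∧ b' ⊆ b ∧ b ∩ F ⊆ b' := by
    obtain ⟨e, heb, heF⟩ := hbF
    change ∃ b', (M ／ C ＼ D)✶.IsCircuit b' ∧ b' ⊆ b ∧ b ∩ F ⊆ b'
    rw [dual_contract_delete, ← contract_delete_comm _ hCD.symm]
    refine (hBc b hb).isCircuit.exists_isCircuit_minor (hbD b (Or.inl hb)) heb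
      (fun h => h.1.2 (hFG heF)) ?_
    rintro f ⟨hfb, hfF⟩ hfe
    refine ⟨L b e f, dual_isCocircuit_iff.2 (hLc b e f ⟨hBc b hb, heb, hfb, hfe⟩), ?_,
      hoD _ (Or.inr ⟨b, hb, e, heF, f, hfF, ⟨heb, hfb, hfe⟩, rfl⟩)⟩
    rw [Set.inter_comm]
    exact hLb b e f ⟨hBc b hb, heb, hfb, hfe⟩
  choose! φ hφc hφo hφF using hφ
  choose! ψ hψc hψb hψF using hψ
  refine ⟨M ／ C ＼ D, φ, ψ, contract_delete_isMinor M C D, ⟨?_⟩, ?_⟩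
  · refine hGfin.subset ?_
    rintro x ⟨⟨hxE, hxC⟩, hxD⟩
    exact by_contra fun hxG => hxD ⟨⟨hxE, hxG⟩, hxC⟩
  · rintro o ho b hb ⟨e, heo, heb⟩
    have hobF : o ∩ b ⊆ F := fun x hx => ⟨⟨o, ho, hx.1⟩, b, hb, hx.2⟩
    have h1 : (o ∩ F).Nonempty := ⟨e, heo, hobF ⟨heo, heb⟩⟩
    have h2 : (b ∩ F).Nonempty := ⟨e, heb, hobF ⟨heo, heb⟩⟩
    refine ⟨hφc o ho h1, hψc b hb h2, Set.Subset.antisymm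
      (Set.inter_subset_inter (hφo o ho h1) (hψb b hb h2)) fun x hx => ?_⟩
    exact ⟨hφF o ho h1 ⟨hx.1, hobF hx⟩, hψF b hb h2 ⟨hx.2, hobF hx⟩⟩

/-- A tame matroid all of whose finite minors are signable is signable. -/
lemma IsTame.isSignable (hM : M.IsTame)
    (h : ∀ N : Matroid α, N ≤m M → N.Finite → N.IsSignable) : M.IsSignable := by
  classical
  -- Each condition involves finitely many coordinates of a product of copies of `ℤˣ`, so it is
  -- closed in a compact space; finite minors give the finite intersection property.
  let S : {o // M.IsCircuit o} × {b // M.IsCocircuit b} →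
      Set ((Set α → α → ℤˣ) × (Set α → α → ℤˣ)) := fun p =>
    {s | ∑ᶠ e ∈ p.1.1 ∩ p.2.1, (s.1 p.1 e : ℤ) * (s.2 p.2 e : ℤ) = 0}
  have hcl (p) : IsClosed (S p) := by
    have hfin := hM _ _ p.1.2 p.2.2
    simp only [S, finsum_mem_eq_finite_toFinset_sum _ hfin]
    refine isClosed_eq (continuous_finsetSum _ fun e _ => ?_) continuous_const
    fun_prop
  have hne (u : Finset ({o // M.IsCircuit o} × {b // M.IsCocircuit b})) :
      (Set.univ ∩ ⋂ p ∈ u, S p).Nonempty := by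
    obtain ⟨N, φ, ψ, hNM, hN, hφψ⟩ := hM.exists_finite_minor
      (O := (fun p => p.1.1) '' (u : Set ({o // M.IsCircuit o} × {b // M.IsCocircuit b})))
      (B := (fun p => p.2.1) '' (u : Set ({o // M.IsCircuit o} × {b // M.IsCocircuit b})))
      (u.finite_toSet.image _) (u.finite_toSet.image _)
      (by rintro _ ⟨p, -, rfl⟩; exact p.1.2) (by rintro _ ⟨p, -, rfl⟩; exact p.2.2)
    obtain ⟨c, d, hcd⟩ := h N hNM hN
    refine ⟨(fun o => c (φ o), fun b => d (ψ b)), trivial, ?_⟩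
    simp only [Set.mem_iInter]
    intro p hp
    change ∑ᶠ e ∈ p.1.1 ∩ p.2.1, (c (φ p.1) e : ℤ) * (d (ψ p.2) e : ℤ) = 0
    obtain h0 | h0 := Set.eq_empty_or_nonempty (p.1.1 ∩ p.2.1)
    · simp [h0]
    · obtain ⟨h1, h2, h3⟩ := hφψ _ ⟨p, hp, rfl⟩ _ ⟨p, hp, rfl⟩ h0
      rw [← h3]
      exact (hcd _ _ h1 h2).2
  obtain ⟨s, -, hs⟩ := isCompact_univ.inter_iInter_nonempty S hcl hne
  simp only [Set.mem_iInter] at hs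
  exact ⟨s.1, s.2, fun o b ho hb => ⟨hM o b ho hb, hs (⟨o, ho⟩, ⟨b, hb⟩)⟩⟩

end Matroid

theorem theorem5p2 {α : Type u} (M : Matroid α) (hM : M.IsTame) :
    List.TFAE [
      ∀ (k : Type w) [Field k], M.IsThinSums k,
      M.IsSignable,
      ∀ N : Matroid α, N.IsMinor M → N.Finite → N.IsRegular] := by
  -- The lift places the prime field in the universe `w` over which the fields range.
  have (p : ℕ) [Fact p.Prime] (h : ∀ (k : Type w) [Field k], M.IsThinSums k) :
      M.IsPaintable (ZMod p) :=
    ((h (ULift.{w} (ZMod p))).isPaintable hM).map ULift.ringEquiv.toRingHom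
  tfae_have 1 → 3 := fun h N hNM hN =>
    Matroid.IsPaintable.isRegular hN ((this 2 h).of_isMinor hNM) ((this 3 h).of_isMinor hNM)
  tfae_have 3 → 2 := fun h => hM.isSignable fun N hNM hN => (h N hNM hN).isSignable hN
  tfae_have 2 → 1 := fun h k _ => (h.isPaintable k).isThinSums
  tfae_finish
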